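/- Let $R\subset[0,\infty)$ be closed and discrete, let $(a_\beta)_{\beta\in R}$ be complex numbers, and let $D=\sum_{\beta\in R}a_\beta\delta_\beta$. Its iterated primitives supported on $[0,\infty)$ are $(ID)(t)=\sum_{\beta\in R,\ \beta\le t}a_\beta$ and $(I^{n+1}D)(t)=\int_0^t (I^nD)(s)\,ds$ for $n\ge1$. A sequence $(t_n)_{n\ge 0}$ in $[0,\infty]$ is called admissible if it is weakly increasing, $t_0=0$, $t_n\to\infty$ and $\liminf_n t_n/n>0$. The diagonal integration by parts (DIPP) along $(t_n)$ converges at $w\in\mathbb C$ if \[ \sum_{\beta\in R,\ \beta\le t_1}|a_\beta e^{\beta w}|+\sum_{n\ge1}\int_{t_n}^{t_{n+1}}|(I^nD)(t)|\,|w^ne^{tw}|\,dt+\sum_{n\ge1,\ t_n<\infty}|(I^nD)(t_n)|\,|w^{n-1}e^{t_nw}|<\infty , \] and its value at such a point is \[ I^{\Delta}_{(t_n)}(D,e^{tw})=\sum_{\beta\in R,\ \beta\le t_1}a_\beta e^{\beta w}+\sum_{n\ge1}(-1)^n\int_{t_n}^{t_{n+1}}(I^nD)(t)\,w^ne^{tw}\,dt+\sum_{n\ge1,\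 t_n<\infty}(-1)^n(I^nD)(t_n)\,w^{n-1}e^{t_nw} \] (the first sum is the term $n=0$, i.e. $\int_{[0,t_1]}D(t)e^{tw}\,dt$; integrals over $[\infty,\infty]$ are $0$). A set $H\subset\mathbb C$ is a neighborhood of $-\infty$ if for every $\theta\in(0,\pi/2)$ there is $c\in\mathbb R$ such that $H$ contains the cone $\{w : |\operatorname{Im}w|<\tan\theta\,(c-\operatorname{Re}w)\}$. Proposition. Let $(t_n)$ and $(s_n)$ be admissible sequences, and let $H_t$ and $H_s$ be connected open neighborhoods of $-\infty$ such that the DIPP along $(t_n)$ converges at every point of $H_t$ and the DIPP along $(s_n)$ converges at every point of $H_s$. Then for every $w\in H_t\cap H_s$, \[ I^{\Delta}_{(t_n)}(D,e^{tw})=I^{\Delta}_{(s_n)}(D,e^{tw}). \] -/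

import Mathlib

open Filter Topology MeasureTheory
open scoped ENNReal

noncomputable section

namespace DIPP

/-- `iterPrim R a m` is the function `I^(m+1) D`, where `D = ∑_{β ∈ R} a_β δ_β` and `I` is the
primitive supported on `[0, ∞)`. The first primitive is the step function
`(I D)(t) = D([0, t]) = ∑_{β ∈ R, β ≤ t} a_β`, a finite sum when `R ⊆ [0, ∞)` is closed and
discrete; then `(I^(m+2) D)(t) = ∫_0^t (I^(m+1) D)(s) ds`. -/
def iterPrim (R : Set ℝ) (a : ℝ → ℂ) : ℕ → ℝ → ℂ
  | 0 => fun t => ∑' β : {β : ℝ // β ∈ R ∧ β ≤ t}, a β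
  | m + 1 => fun t => ∫ s in (0 : ℝ)..t, iterPrim R a m s

/-- The real points of the interval `[t_n, t_(n+1)]`, where the value `⊤` is allowed for `t_n`. -/
def seg (t : ℕ → EReal) (n : ℕ) : Set ℝ :=
  {τ : ℝ | t n ≤ (τ : EReal) ∧ (τ : EReal) ≤ t (n + 1)}

/-- The sum of all absolute values in the diagonal integration by parts of `⟨D, e^{tw}⟩` along
`(t_n)`, at the point `w`. The first sum is the term `n = 0`, that is
`∫_{[t_0, t_1]} |D(t)| |e^{tw}| dt`. There is no border term at an infinite `t_n`. -/
def absSum (R : Set ℝ) (a : ℝ → ℂ) (t : ℕ → EReal) (w : ℂ) : ℝ≥0∞ :=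
  (∑' β : {β : ℝ // β ∈ R ∧ (β : EReal) ≤ t 1}, ‖a β * Complex.exp (((β : ℝ) : ℂ) * w)‖ₑ)
  + (∑' m : ℕ, ∫⁻ τ in seg t (m + 1),
      ‖iterPrim R a m τ * w ^ (m + 1) * Complex.exp ((τ : ℂ) * w)‖ₑ)
  + ∑' m : ℕ, if t (m + 1) = ⊤ then 0 else
      ‖iterPrim R a m (t (m + 1)).toReal * w ^ m
        * Complex.exp (((t (m + 1)).toReal : ℂ) * w)‖ₑ

/-- The diagonal integration by parts along `(t_n)` converges at `w`. -/
def ConvergesAt (R : Set ℝ) (a : ℝ → ℂ) (t : ℕ → EReal) (w : ℂ) : Prop :=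
  absSum R a t w < ⊤

/-- The value at `w` of the diagonal integration by parts along `(t_n)`:
`∑_{n ≥ 0} (-1)^n ∫_{t_n}^{t_(n+1)} (I^n D)(t) w^n e^{tw} dt
  + ∑_{n ≥ 1} (-1)^n (I^n D)(t_n) w^(n-1) e^{t_n w}`. The term `n = 0` is written first; in the
other sums `n = m + 1`. -/
def value (R : Set ℝ) (a : ℝ → ℂ) (t : ℕ → EReal) (w : ℂ) : ℂ :=
  (∑' β : {β : ℝ // β ∈ R ∧ (β : EReal) ≤ t 1}, a β * Complex.exp (((β : ℝ) : ℂ) * w))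
  + (∑' m : ℕ, (-1) ^ (m + 1) * ∫ τ in seg t (m + 1),
      iterPrim R a m τ * w ^ (m + 1) * Complex.exp ((τ : ℂ) * w))
  + ∑' m : ℕ, if t (m + 1) = ⊤ then 0 else
      (-1) ^ (m + 1) * (iterPrim R a m (t (m + 1)).toReal * w ^ m
        * Complex.exp (((t (m + 1)).toReal : ℂ) * w))

/-- Admissible sequences; the value `⊤` is allowed (only finitely many integrations by parts). -/
structure Admissible (t : ℕ → EReal) : Prop where
  mono : Monotone t
  zero : t 0 = 0
  tendsto : Tendsto t atTop (𝓝 ⊤)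
  growth : 0 < liminf (fun n : ℕ => t n / (n : EReal)) atTop

/-- Neighborhoods of `-∞`: for each `θ < π / 2`, the set contains a left-handed cone of opening
`2 θ` with vertex on the real axis and symmetric about that axis. -/
def IsNbhdNegInf (H : Set ℂ) : Prop :=
  ∀ θ : ℝ, 0 < θ → θ < Real.pi / 2 →
    ∃ c : ℝ, {w : ℂ | |w.im| < Real.tan θ * (c - w.re)} ⊆ H

end DIPP

end

namespace DIPP

open Set

/-! Cut a DIPP off at a real `T ≥ 0`. Integrations by parts on `[0, T]` collapse it to the finite
sum of atoms up to `T` minus the border terms at `T` of order below `n`, where `t n ≤ T < t (n + 1)`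
(`truncValue_eq_remainder`). The sequence enters this `remainder` only through `n`, so two truncated
DIPPs differ by the border terms at `T` with orders between the two indices.

At `-r`, the border terms at `T` of order at least `n` have total modulus at most `absSum`,
uniformly in `T` (`sum_border_le_absSum`). Passing from `-r` to `-2r` multiplies the term of order
`k` by `2 ^ k * exp (-r T)` in modulus. Admissibility makes the indices grow at most linearly in
`T`, so for large `r` this factor kills the difference as `T → ∞`, and the values agree far to the
left on the real axis (`exists_value_eq_of_large`).

The identity theorem spreads the equality. Since `Ht ∩ Hs` need not be connected, both values are
continued to the larger sets `domHull Ht` and `domHull Hs`: convergence at `w'` forces convergence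
wherever real part and modulus are both smaller. The intersection of these hulls is connected. -/

/-! ### Locally finite atomic measures -/

theorem finite_inter_Iic {R : Set ℝ} (h0 : ∀ β ∈ R, 0 ≤ β) (hc : IsClosed R)
    (hd : DiscreteTopology R) (T : ℝ) : (R ∩ Iic T).Finite := by
  have h1 : R ∩ Iic T = R ∩ Icc 0 T := by
    ext x
    constructor
    · rintro ⟨h, h'⟩
      exact ⟨h, h0 x h, h'⟩
    · rintro ⟨h, h'⟩
      exact ⟨h, h'.2⟩
  rw [h1]
  refine IsCompact.finite (isCompact_Icc.inter_left hc) ?_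
  exact IsDiscrete.mono ⟨hd⟩ inter_subset_left

/-- On `(-∞, T]` the distribution function of `∑ c_β δ_β` is a finite sum of step functions. -/
theorem tsum_le_eq_sum {E : Type*} [NormedAddCommGroup E] {R : Set ℝ} {T : ℝ}
    (hf : (R ∩ Iic T).Finite) (c : ℝ → E) {x : ℝ} (hx : x ≤ T) :
    ∑' β : {β : ℝ // β ∈ R ∧ β ≤ x}, c β =
      ∑ β ∈ hf.toFinset, (Ici β).indicator (fun _ => c β) x := by
  have h1 : ∑' β : {β : ℝ // β ∈ R ∧ β ≤ x}, c β =
      ∑' β : ℝ, ({β : ℝ | β ∈ R ∧ β ≤ x}).indicator c β := tsum_subtype {β : ℝ | β ∈ R ∧ β ≤ x} c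
  rw [h1, tsum_eq_sum (s := hf.toFinset)]
  · refine Finset.sum_congr rfl fun β hβ => ?_
    have : β ∈ R := by simpa using ((Set.Finite.mem_toFinset hf).1 hβ).1
    by_cases h : β ≤ x <;> simp [indicator, h, this]
  · intro β hβ
    refine indicator_of_notMem ?_ _
    rintro ⟨h, h'⟩
    exact hβ ((Set.Finite.mem_toFinset hf).2 ⟨h, h'.trans hx⟩)

/-- Integration by parts of an atomic measure on `[0, ∞)` against a smooth function. -/
theorem tsum_mul_eq_sub_integral {𝕜 : Type*} [RCLike 𝕜] {R : Set ℝ} (h0 : ∀ β ∈ R, 0 ≤ β)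
    {x : ℝ} (hf : (R ∩ Iic x).Finite) (c : ℝ → 𝕜) {e e' : ℝ → 𝕜}
    (he : ∀ τ, HasDerivAt e (e' τ) τ) (he' : Continuous e') (hx : 0 ≤ x) :
    ∑' β : {β : ℝ // β ∈ R ∧ β ≤ x}, c β * e β =
      (∑' β : {β : ℝ // β ∈ R ∧ β ≤ x}, c β) * e x
        - ∫ τ in (0 : ℝ)..x, (∑' β : {β : ℝ // β ∈ R ∧ β ≤ τ}, c β) * e' τ := by
  have hI : ∫ τ in (0 : ℝ)..x, (∑' β : {β : ℝ // β ∈ R ∧ β ≤ τ}, c β) * e' τ =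
      ∑ β ∈ hf.toFinset, c β * (e x - e β) := by
    have h1 : ∫ τ in (0 : ℝ)..x, (∑' β : {β : ℝ // β ∈ R ∧ β ≤ τ}, c β) * e' τ =
        ∫ τ in Icc 0 x, ∑ β ∈ hf.toFinset, (Ici β).indicator (fun τ => c β * e' τ) τ := by
      rw [intervalIntegral.integral_of_le hx, ← integral_Icc_eq_integral_Ioc]
      refine setIntegral_congr_fun measurableSet_Icc fun τ hτ => ?_
      rw [tsum_le_eq_sum hf c hτ.2, Finset.sum_mul]
      refine Finset.sum_congr rfl fun β _ => ?_
      by_cases h : β ≤ τ <;> simp [indicator, h]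
    rw [h1, integral_finsetSum]
    · refine Finset.sum_congr rfl fun β hβ => ?_
      obtain ⟨hβR, hβx⟩ := (Set.Finite.mem_toFinset hf).1 hβ
      have hβ0 := h0 β hβR
      rw [setIntegral_indicator measurableSet_Ici]
      have : Icc 0 x ∩ Ici β = Icc β x := by
        ext τ
        simp only [mem_inter_iff, mem_Icc, mem_Ici]
        exact ⟨fun h => ⟨h.2, h.1.2⟩, fun h => ⟨⟨hβ0.trans h.1, h.2⟩, h.1⟩⟩
      rw [this, integral_Icc_eq_integral_Ioc, ← intervalIntegral.integral_of_le hβx,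
        intervalIntegral.integral_const_mul,
        intervalIntegral.integral_eq_sub_of_hasDerivAt (fun τ _ => he τ)
          (he'.intervalIntegrable _ _)]
    · intro β _
      refine IntegrableOn.indicator ?_ measurableSet_Ici
      exact (continuous_const.mul he').integrableOn_Icc
  rw [hI, tsum_le_eq_sum hf c le_rfl, tsum_le_eq_sum hf (fun β => c β * e β) le_rfl,
    Finset.sum_mul, ← Finset.sum_sub_distrib]
  refine Finset.sum_congr rfl fun β hβ => ?_
  have : β ≤ x := ((Set.Finite.mem_toFinset hf).1 hβ).2
  simp only [indicator, mem_Ici, this, if_true]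
  ring

/-! ### Regularity of the iterated primitives -/

section Regularity

variable {E : Type*} [NormedAddCommGroup E] {R : Set ℝ}

/-- The first primitive may jump at the atoms; right-continuity is what remains, and it gives its
own primitive a right derivative everywhere, enough for integration by parts. -/
theorem tsum_le_rightContinuous (hf : ∀ T, (R ∩ Iic T).Finite) (c : ℝ → E) (x : ℝ) :
    ContinuousWithinAt (fun x => ∑' β : {β : ℝ // β ∈ R ∧ β ≤ x}, c β) (Ici x) x := by
  have h : ContinuousWithinAt (fun y => ∑ β ∈ (hf (x + 1)).toFinset,
      (Ici β).indicator (fun _ => c β) y) (Ici x) x := by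
    refine tendsto_finsetSum _ fun β _ => ?_
    by_cases hβ : β ≤ x
    · refine tendsto_const_nhds.congr' ?_
      filter_upwards [self_mem_nhdsWithin] with y hy
      have hy' : β ≤ y := hβ.trans hy
      simp [indicator, hβ, hy']
    · refine tendsto_const_nhds.congr' ?_
      filter_upwards [mem_nhdsWithin_of_mem_nhds (Iio_mem_nhds (not_le.1 hβ))] with y hy
      have hy' : ¬ β ≤ y := not_le.2 hy
      simp [indicator, hβ, hy']
  refine h.congr_of_eventuallyEq ?_ (tsum_le_eq_sum _ c (by linarith))
  filter_upwards [mem_nhdsWithin_of_mem_nhds (Iio_mem_nhds (lt_add_one x))] with y hy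
  exact tsum_le_eq_sum _ c (le_of_lt hy)

theorem tsum_le_intervalIntegrable (hf : ∀ T, (R ∩ Iic T).Finite) (c : ℝ → E) (x y : ℝ) :
    IntervalIntegrable (fun x => ∑' β : {β : ℝ // β ∈ R ∧ β ≤ x}, c β) volume x y := by
  have h : IntervalIntegrable (fun z => ∑ β ∈ (hf (max x y)).toFinset,
      (Ici β).indicator (fun _ => c β) z) volume x y := by
    have : IntervalIntegrable (∑ β ∈ (hf (max x y)).toFinset,
      (Ici β).indicator (fun _ => c β)) volume x y := by
      refine IntervalIntegrable.sum _ fun β _ => ?_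
      rw [intervalIntegrable_iff]
      exact (integrableOn_const (by simp)).indicator measurableSet_Ici
    convert this using 1
    ext z
    simp
  refine h.congr fun z hz => ?_
  exact (tsum_le_eq_sum _ c hz.2).symm

variable {a : ℝ → ℂ}

theorem iterPrim_intervalIntegrable (hf : ∀ T, (R ∩ Iic T).Finite) (m : ℕ) (x y : ℝ) :
    IntervalIntegrable (iterPrim R a m) volume x y := by
  induction m generalizing x y with
  | zero => exact tsum_le_intervalIntegrable hf a x y
  | succ m ih =>
    exact (intervalIntegral.continuous_primitive ih 0).intervalIntegrable _ _

theorem iterPrim_succ_continuous (hf : ∀ T, (R ∩ Iic T).Finite) (m : ℕ) :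
    Continuous (iterPrim R a (m + 1)) :=
  intervalIntegral.continuous_primitive (iterPrim_intervalIntegrable hf m) 0

theorem iterPrim_rightContinuous (hf : ∀ T, (R ∩ Iic T).Finite) (m : ℕ) (x : ℝ) :
    ContinuousWithinAt (iterPrim R a m) (Ici x) x := by
  cases m with
  | zero => exact tsum_le_rightContinuous hf a x
  | succ m => exact (iterPrim_succ_continuous hf m).continuousWithinAt

theorem iterPrim_aestronglyMeasurable (hf : ∀ T, (R ∩ Iic T).Finite) (m : ℕ) :
    AEStronglyMeasurable (iterPrim R a m) volume := by
  have : LocallyIntegrable (iterPrim R a m) volume := by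
    intro x
    refine ⟨Ioc (x - 1) (x + 1), Ioc_mem_nhds (by linarith) (by linarith), ?_⟩
    exact (intervalIntegrable_iff_integrableOn_Ioc_of_le (by linarith)).1
      (iterPrim_intervalIntegrable hf m _ _)
  exact this.aestronglyMeasurable

theorem iterPrim_succ_apply_zero (m : ℕ) : iterPrim R a (m + 1) 0 = 0 :=
  intervalIntegral.integral_same

theorem iterPrim_succ_sub (hf : ∀ T, (R ∩ Iic T).Finite) (m : ℕ) (x y : ℝ) :
    iterPrim R a (m + 1) y = iterPrim R a (m + 1) x + ∫ τ in x..y, iterPrim R a m τ :=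
  (intervalIntegral.integral_add_adjacent_intervals
    (iterPrim_intervalIntegrable hf m 0 x) (iterPrim_intervalIntegrable hf m x y)).symm

end Regularity

/-! ### Finite integrations by parts and the remainder -/

/-- Integration by parts for the primitive of a right-continuous function. -/
theorem integral_mul_eq_of_rightContinuous {𝕜 : Type*} [RCLike 𝕜] {f : ℝ → 𝕜}
    (hfi : ∀ x y, IntervalIntegrable f volume x y)
    (hfc : ∀ x, ContinuousWithinAt f (Ici x) x) {e e' : ℝ → 𝕜}
    (he : ∀ τ, HasDerivAt e (e' τ) τ) (he' : Continuous e') (C : 𝕜) (x y : ℝ) :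
    ∫ τ in x..y, f τ * e τ =
      (C + ∫ σ in x..y, f σ) * e y - C * e x
        - ∫ τ in x..y, (C + ∫ σ in x..τ, f σ) * e' τ := by
  have hcont : Continuous fun τ => C + ∫ σ in x..τ, f σ :=
    continuous_const.add (intervalIntegral.continuous_primitive hfi x)
  -- The primitive need not be differentiable at a jump of `f`, so the version with right
  -- derivatives is used.
  have key := intervalIntegral.integral_mul_deriv_eq_deriv_mul_of_hasDeriv_right
    (a := x) (b := y) (u := fun τ => C + ∫ σ in x..τ, f σ) (v := e) (u' := f) (v' := e')
    hcont.continuousOn (fun τ _ => (he τ).continuousAt.continuousWithinAt)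
    (fun τ _ => by
      have h := intervalIntegral.integral_hasDerivWithinAt_right (hfi x τ) (s := Ici τ)
        (t := Ioi τ) ⟨Ioc (τ - 1) (τ + 1), mem_nhdsWithin_of_mem_nhds
          (Ioc_mem_nhds (by linarith) (by linarith)), ((intervalIntegrable_iff_integrableOn_Ioc_of_le
            (by linarith)).1 (hfi (τ - 1) (τ + 1))).aestronglyMeasurable⟩
        ((hfc τ).mono Ioi_subset_Ici_self)
      exact (h.mono Ioi_subset_Ici_self).const_add C)
    (fun τ _ => (he τ).hasDerivWithinAt) (hfi x y) (he'.intervalIntegrable _ _)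
  rw [key]
  simp

theorem norm_exp_ofReal_mul (τ : ℝ) (w : ℂ) :
    ‖Complex.exp ((τ : ℂ) * w)‖ = Real.exp (τ * w.re) := by
  rw [Complex.norm_exp]
  simp

theorem hasDerivAt_exp_ofReal_mul (w : ℂ) (τ : ℝ) :
    HasDerivAt (fun τ : ℝ => Complex.exp ((τ : ℂ) * w)) (w * Complex.exp ((τ : ℂ) * w)) τ := by
  have h : HasDerivAt (fun τ : ℝ => (τ : ℂ) * w) (1 * w) τ :=
    (Complex.ofRealCLM.hasDerivAt (x := τ)).mul_const w
  have := h.cexp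
  rwa [one_mul, mul_comm] at this

theorem hasDerivAt_exp_neg_mul (r τ : ℝ) :
    HasDerivAt (fun τ : ℝ => Real.exp (-(r * τ))) (-r * Real.exp (-(r * τ))) τ := by
  have h : HasDerivAt (fun τ : ℝ => -(r * τ)) (-(r * 1)) τ := ((hasDerivAt_id τ).const_mul r).neg
  have := h.exp
  rwa [mul_one, mul_comm] at this

/-- What is left of `∫_{[0, x]} D(τ) e^{τw} dτ` after removing the border terms at `x` of `n`
integrations by parts. -/
noncomputable def remainder (R : Set ℝ) (a : ℝ → ℂ) (w : ℂ) (n : ℕ) (x : ℝ) : ℂ :=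
  (∑' β : {β : ℝ // β ∈ R ∧ β ≤ x}, a β * Complex.exp (((β : ℝ) : ℂ) * w))
    - ∑ k ∈ Finset.range n, (-1) ^ k * (iterPrim R a k x * w ^ k * Complex.exp ((x : ℂ) * w))

section

variable {R : Set ℝ} {a : ℝ → ℂ}

theorem integrand_intervalIntegrable (hf : ∀ T, (R ∩ Iic T).Finite) (w : ℂ) (m k : ℕ) (x y : ℝ) :
    IntervalIntegrable (fun τ : ℝ => iterPrim R a m τ * w ^ k * Complex.exp ((τ : ℂ) * w))
      volume x y :=
  ((iterPrim_intervalIntegrable hf m x y).mul_const _).mul_continuousOn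
    (by fun_prop)

/-- Each integration by parts produces a border term at `x` only, because the higher primitives
vanish at `0`. As a pure integral, the remainder of positive order changes additively when `x`
moves. -/
theorem remainder_succ_eq_integral (h0 : ∀ β ∈ R, 0 ≤ β) (hf : ∀ T, (R ∩ Iic T).Finite) (w : ℂ)
    (n : ℕ) {x : ℝ} (hx : 0 ≤ x) :
    remainder R a w (n + 1) x = (-1) ^ (n + 1) *
      ∫ τ in (0 : ℝ)..x, iterPrim R a n τ * w ^ (n + 1) * Complex.exp ((τ : ℂ) * w) := by
  induction n with
  | zero =>
    have h := tsum_mul_eq_sub_integral h0 (hf x) a (hasDerivAt_exp_ofReal_mul w)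
      (by fun_prop) hx
    simp only [remainder, h]
    simp [iterPrim, mul_assoc]
  | succ n ih =>
    have h := integral_mul_eq_of_rightContinuous (iterPrim_intervalIntegrable (a := a) hf n)
      (iterPrim_rightContinuous hf n) (hasDerivAt_exp_ofReal_mul w) (by fun_prop) 0 0 x
    have hs : remainder R a w (n + 1 + 1) x = remainder R a w (n + 1) x - (-1) ^ (n + 1) *
        (iterPrim R a (n + 1) x * w ^ (n + 1) * Complex.exp ((x : ℂ) * w)) := by
      simp only [remainder, Finset.sum_range_succ _ (n + 1)]
      ring
    have h1 : ∫ τ in (0 : ℝ)..x, iterPrim R a n τ * w ^ (n + 1) * Complex.exp ((τ : ℂ) * w) =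
        w ^ (n + 1) * ∫ τ in (0 : ℝ)..x, iterPrim R a n τ * Complex.exp ((τ : ℂ) * w) := by
      rw [← intervalIntegral.integral_const_mul]
      congr 1
      ext τ
      ring
    have h2 : ∫ τ in (0 : ℝ)..x,
          iterPrim R a (n + 1) τ * w ^ (n + 1 + 1) * Complex.exp ((τ : ℂ) * w) =
        w ^ (n + 1) * ∫ τ in (0 : ℝ)..x,
          (0 + ∫ σ in (0 : ℝ)..τ, iterPrim R a n σ) * (w * Complex.exp ((τ : ℂ) * w)) := by
      rw [← intervalIntegral.integral_const_mul]
      congr 1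
      ext τ
      simp only [iterPrim, zero_add]
      ring
    rw [hs, ih, h1, h, h2]
    simp only [iterPrim, zero_add, zero_mul, sub_zero]
    ring

/-- The diagonal integration by parts along the first breakpoints, up to the last of them. -/
theorem partial_dipp_eq_remainder (h0 : ∀ β ∈ R, 0 ≤ β) (hf : ∀ T, (R ∩ Iic T).Finite) (w : ℂ)
    (x : ℕ → ℝ) (hx : ∀ n, 0 ≤ x n) (n : ℕ) :
    (∑' β : {β : ℝ // β ∈ R ∧ β ≤ x 1}, a β * Complex.exp (((β : ℝ) : ℂ) * w))
      + (∑ m ∈ Finset.range n, (-1) ^ (m + 1) * ∫ τ in (x (m + 1))..(x (m + 2)),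
          iterPrim R a m τ * w ^ (m + 1) * Complex.exp ((τ : ℂ) * w))
      + ∑ m ∈ Finset.range n, (-1) ^ (m + 1) *
          (iterPrim R a m (x (m + 1)) * w ^ m * Complex.exp ((x (m + 1) : ℂ) * w))
      = remainder R a w n (x (n + 1)) := by
  induction n with
  | zero => simp [remainder]
  | succ n ih =>
    -- The border term at `x (n + 1)` raises the order of the remainder there; the integral over the
    -- next segment then moves its endpoint to `x (n + 2)`.
    have hs : remainder R a w (n + 1) (x (n + 1)) = remainder R a w n (x (n + 1)) - (-1) ^ n *
        (iterPrim R a n (x (n + 1)) * w ^ n * Complex.exp ((x (n + 1) : ℂ) * w)) := by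
      simp only [remainder, Finset.sum_range_succ _ n]
      ring
    have h1 := remainder_succ_eq_integral (a := a) h0 hf w n (hx (n + 1))
    have h2 := remainder_succ_eq_integral (a := a) h0 hf w n (hx (n + 2))
    have h3 := intervalIntegral.integral_add_adjacent_intervals
      (integrand_intervalIntegrable (a := a) hf w n (n + 1) 0 (x (n + 1)))
      (integrand_intervalIntegrable hf w n (n + 1) (x (n + 1)) (x (n + 2)))
    rw [← h3, mul_add, ← h1, hs, ← ih] at h2
    rw [h2, Finset.sum_range_succ, Finset.sum_range_succ]
    ring

end

/-! ### Uniform bounds for border terms on the negative real axis -/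

/-- The modulus of the border term of order `k` at the point `-r`. -/
noncomputable def border (R : Set ℝ) (a : ℝ → ℂ) (r : ℝ) (k : ℕ) (x : ℝ) : ℝ :=
  ‖iterPrim R a k x‖ * r ^ k * Real.exp (-(r * x))

theorem border_nonneg (R : Set ℝ) (a : ℝ → ℂ) {r : ℝ} (hr : 0 ≤ r) (k : ℕ) (x : ℝ) :
    0 ≤ border R a r k x := by
  unfold border
  positivity

section

variable {R : Set ℝ} {a : ℝ → ℂ}

theorem border_intervalIntegrable (hf : ∀ T, (R ∩ Iic T).Finite) (r : ℝ) (k : ℕ) (x y : ℝ) :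
    IntervalIntegrable (border R a r k) volume x y :=
  ((iterPrim_intervalIntegrable hf k x y).norm.mul_const _).mul_continuousOn (by fun_prop)

/-- Integration by parts gives equality when the modulus of the higher primitive is replaced by its
majorant `ψ`, which starts from the same value at `x` and grows at the rate `‖iterPrim R a k‖`. Both
terms on the left are monotone in that modulus. -/
theorem border_succ_add_integral_le (hf : ∀ T, (R ∩ Iic T).Finite) {r : ℝ} (hr : 0 ≤ r) (k : ℕ)
    {x y : ℝ} (hxy : x ≤ y) :
    border R a r (k + 1) y + r * ∫ τ in x..y, border R a r (k + 1) τ ≤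
      border R a r (k + 1) x + r * ∫ τ in x..y, border R a r k τ := by
  set ψ : ℝ → ℝ := fun τ => ‖iterPrim R a (k + 1) x‖ + ∫ σ in x..τ, ‖iterPrim R a k σ‖ with hψ
  have hgi : ∀ x y, IntervalIntegrable (fun τ => ‖iterPrim R a k τ‖) volume x y :=
    fun x y => (iterPrim_intervalIntegrable hf k x y).norm
  have hψc : Continuous ψ :=
    continuous_const.add (intervalIntegral.continuous_primitive hgi x)
  have hle : ∀ τ, x ≤ τ → ‖iterPrim R a (k + 1) τ‖ ≤ ψ τ := by
    intro τ hτ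
    rw [iterPrim_succ_sub hf k x τ]
    exact (norm_add_le _ _).trans
      (add_le_add le_rfl (intervalIntegral.norm_integral_le_integral_norm hτ))
  have h := integral_mul_eq_of_rightContinuous hgi
    (fun x => (iterPrim_rightContinuous hf k x).norm) (hasDerivAt_exp_neg_mul r) (by fun_prop)
    ‖iterPrim R a (k + 1) x‖ x y
  change _ = ψ y * _ - _ - ∫ τ in x..y, ψ τ * _ at h
  have e1 : r * ∫ τ in x..y, border R a r k τ =
      r ^ (k + 1) * ∫ τ in x..y, ‖iterPrim R a k τ‖ * Real.exp (-(r * τ)) := by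
    rw [← intervalIntegral.integral_const_mul, ← intervalIntegral.integral_const_mul]
    congr 1
    ext τ
    simp only [border]
    ring
  have e2 : ∫ τ in x..y, ψ τ * (-r * Real.exp (-(r * τ))) =
      -(r * ∫ τ in x..y, ψ τ * Real.exp (-(r * τ))) := by
    rw [← intervalIntegral.integral_const_mul, ← intervalIntegral.integral_neg]
    congr 1
    ext τ
    ring
  have i1 : ∫ τ in x..y, border R a r (k + 1) τ ≤
      r ^ (k + 1) * ∫ τ in x..y, ψ τ * Real.exp (-(r * τ)) := by
    rw [← intervalIntegral.integral_const_mul]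
    refine intervalIntegral.integral_mono_on hxy (border_intervalIntegrable hf r _ x y)
      (Continuous.intervalIntegrable (by fun_prop) _ _) fun τ hτ => ?_
    have := mul_le_mul_of_nonneg_right (hle τ hτ.1)
      (mul_nonneg (pow_nonneg hr (k + 1)) (Real.exp_pos (-(r * τ))).le)
    simp only [border]
    linarith
  have i2 : border R a r (k + 1) y ≤ r ^ (k + 1) * (ψ y * Real.exp (-(r * y))) := by
    have := mul_le_mul_of_nonneg_right (hle y hxy)
      (mul_nonneg (pow_nonneg hr (k + 1)) (Real.exp_pos (-(r * y))).le)
    simp only [border]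
    linarith
  have i3 := mul_le_mul_of_nonneg_left i1 hr
  rw [e1, h, e2]
  have e3 : border R a r (k + 1) x =
    r ^ (k + 1) * (‖iterPrim R a (k + 1) x‖ * Real.exp (-(r * x))) := by
    simp only [border]
    ring
  rw [e3]
  linarith

/-- Summing the one-step inequality over the orders telescopes the integrals: only the lowest one
survives as a cost, and the highest is nonnegative and dropped. The bound is therefore independent
of `K`. -/
theorem sum_border_le_add_integral (hf : ∀ T, (R ∩ Iic T).Finite) {r : ℝ} (hr : 0 ≤ r) (n K : ℕ)
    {x y : ℝ} (hxy : x ≤ y) :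
    ∑ k ∈ Finset.Ico (n + 1) K, border R a r k y ≤
      ∑ k ∈ Finset.Ico (n + 1) K, border R a r k x + r * ∫ τ in x..y, border R a r n τ := by
  have hnn : ∀ k, 0 ≤ r * ∫ τ in x..y, border R a r k τ := fun k =>
    mul_nonneg hr (intervalIntegral.integral_nonneg hxy fun τ _ => border_nonneg R a hr k τ)
  rcases lt_or_ge K (n + 1) with h | h
  · rw [Finset.Ico_eq_empty (by omega)]
    simpa using hnn n
  · obtain ⟨j, rfl⟩ := Nat.exists_eq_add_of_le h
    have key : ∑ k ∈ Finset.Ico (n + 1) (n + 1 + j), border R a r k y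
        + r * ∫ τ in x..y, border R a r (n + j) τ ≤
        ∑ k ∈ Finset.Ico (n + 1) (n + 1 + j), border R a r k x
          + r * ∫ τ in x..y, border R a r n τ := by
      clear h
      induction j with
      | zero => simp
      | succ j ih =>
        rw [← add_assoc, Finset.sum_Ico_succ_top (by omega), Finset.sum_Ico_succ_top (by omega)]
        have := border_succ_add_integral_le (a := a) hf hr (n + j) hxy
        rw [show n + 1 + j = n + j + 1 by ring] at *
        rw [show n + (j + 1) = n + j + 1 by ring]
        linarith
    linarith [hnn (n + j)]

/-- The starting case on the segment of index `0`: the atoms pay for the border term and the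
integral of order `0`, and the latter pays for all higher border terms, which vanish at the origin.
-/
theorem sum_border_le_tsum (h0 : ∀ β ∈ R, 0 ≤ β) (hf : ∀ T, (R ∩ Iic T).Finite) {r : ℝ}
    (hr : 0 ≤ r) (K : ℕ) {y : ℝ} (hy : 0 ≤ y) :
    ∑ k ∈ Finset.Ico 0 K, border R a r k y ≤
      ∑' β : {β : ℝ // β ∈ R ∧ β ≤ y}, ‖a β‖ * Real.exp (-(r * β)) := by
  have h := tsum_mul_eq_sub_integral h0 (hf y) (fun β => ‖a β‖) (hasDerivAt_exp_neg_mul r)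
    (by fun_prop) hy
  have hle : ∀ τ, τ ≤ y → ‖iterPrim R a 0 τ‖ ≤ ∑' β : {β : ℝ // β ∈ R ∧ β ≤ τ}, ‖a β‖ := by
    intro τ hτ
    change ‖∑' β : {β : ℝ // β ∈ R ∧ β ≤ τ}, a β‖ ≤ _
    rw [tsum_le_eq_sum (hf y) a hτ, tsum_le_eq_sum (hf y) (fun β => ‖a β‖) hτ]
    refine (norm_sum_le _ _).trans_eq (Finset.sum_congr rfl fun β _ => ?_)
    rw [norm_indicator_eq_indicator_norm]
  have hb : ∀ τ, τ ≤ y → border R a r 0 τ ≤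
      (∑' β : {β : ℝ // β ∈ R ∧ β ≤ τ}, ‖a β‖) * Real.exp (-(r * τ)) := by
    intro τ hτ
    simp only [border, pow_zero, mul_one]
    exact mul_le_mul_of_nonneg_right (hle τ hτ) (Real.exp_pos _).le
  have e2 : ∫ τ in (0 : ℝ)..y,
        (∑' β : {β : ℝ // β ∈ R ∧ β ≤ τ}, ‖a β‖) * (-r * Real.exp (-(r * τ))) =
      -(r * ∫ τ in (0 : ℝ)..y,
        (∑' β : {β : ℝ // β ∈ R ∧ β ≤ τ}, ‖a β‖) * Real.exp (-(r * τ))) := by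
    rw [← intervalIntegral.integral_const_mul, ← intervalIntegral.integral_neg]
    congr 1
    ext τ
    ring
  have i1 : ∫ τ in (0 : ℝ)..y, border R a r 0 τ ≤ ∫ τ in (0 : ℝ)..y,
      (∑' β : {β : ℝ // β ∈ R ∧ β ≤ τ}, ‖a β‖) * Real.exp (-(r * τ)) :=
    intervalIntegral.integral_mono_on hy (border_intervalIntegrable hf r _ _ _)
      ((tsum_le_intervalIntegrable hf (fun β => ‖a β‖) 0 y).mul_continuousOn (by fun_prop))
      fun τ hτ => hb τ hτ.2
  have i2 := mul_le_mul_of_nonneg_left i1 hr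
  have i3 := sum_border_le_add_integral (a := a) hf hr 0 K hy
  have i4 : ∑ k ∈ Finset.Ico (0 + 1) K, border R a r k 0 = 0 := by
    refine Finset.sum_eq_zero fun k hk => ?_
    obtain ⟨j, rfl⟩ := Nat.exists_eq_add_of_le' (Finset.mem_Ico.1 hk).1
    rw [border, zero_add, iterPrim_succ_apply_zero]
    simp
  have i5 : ∑ k ∈ Finset.Ico 0 K, border R a r k y ≤
      border R a r 0 y + ∑ k ∈ Finset.Ico (0 + 1) K, border R a r k y := by
    rcases Nat.eq_zero_or_pos K with rfl | hK
    · simpa using border_nonneg R a hr 0 y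
    · rw [Finset.sum_eq_sum_Ico_succ_bot hK]
  rw [h, e2]
  linarith [hb y le_rfl]

theorem summable_tsum_le {E : Type*} [NormedAddCommGroup E] {x : ℝ} (hf : (R ∩ Iic x).Finite)
    (f : {β : ℝ // β ∈ R ∧ β ≤ x} → E) : Summable f := by
  have : Finite {β : ℝ // β ∈ R ∧ β ≤ x} := hf
  exact Summable.of_finite

variable {t : ℕ → EReal}

/-- The uniform bound for the border terms of order at least `n` at a point of the `n`-th
segment. -/
theorem sum_border_le_absSum_aux (h0 : ∀ β ∈ R, 0 ≤ β) (hf : ∀ T, (R ∩ Iic T).Finite)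
    (hmono : Monotone t) (ht0 : t 0 = 0) {r : ℝ} (hr : 0 ≤ r) (n K : ℕ) (T : ℝ)
    (h1 : t n ≤ T) (h2 : (T : EReal) ≤ t (n + 1)) :
    ENNReal.ofReal (∑ k ∈ Finset.Ico n K, border R a r k T) ≤
      (∑' β : {β : ℝ // β ∈ R ∧ (β : EReal) ≤ t 1},
          ‖a β * Complex.exp (((β : ℝ) : ℂ) * ((-r : ℝ) : ℂ))‖ₑ)
      + ∑ m ∈ Finset.range n, ∫⁻ τ in seg t (m + 1),
          ‖iterPrim R a m τ * ((-r : ℝ) : ℂ) ^ (m + 1)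
            * Complex.exp ((τ : ℂ) * ((-r : ℝ) : ℂ))‖ₑ := by
  induction n generalizing T with
  | zero =>
    have hT : 0 ≤ T := by
      rw [ht0] at h1
      exact_mod_cast h1
    refine (ENNReal.ofReal_le_ofReal (sum_border_le_tsum h0 hf hr K hT)).trans ?_
    rw [ENNReal.ofReal_tsum_of_nonneg (fun β => by positivity) (summable_tsum_le (hf T) _)]
    simp only [Finset.range_zero, Finset.sum_empty, add_zero]
    set ι : {β : ℝ // β ∈ R ∧ β ≤ T} → {β : ℝ // β ∈ R ∧ (β : EReal) ≤ t 1} :=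
      fun β => ⟨β, β.2.1, (EReal.coe_le_coe_iff.2 β.2.2).trans h2⟩
    have hι : Function.Injective ι := fun x y h => by
      exact Subtype.ext (Subtype.mk_eq_mk.1 h)
    refine le_trans (le_of_eq (tsum_congr fun β => ?_))
      (ENNReal.tsum_comp_le_tsum_of_injective hι _)
    rw [← ofReal_norm, norm_mul, norm_exp_ofReal_mul]
    simp [ι, mul_comm]
  | succ n ih =>
    have hne : t (n + 1) ≠ ⊤ := fun h => by simp [h] at h1
    have hpos : 0 ≤ t (n + 1) := ht0 ▸ hmono (Nat.zero_le _)
    have hx : ((t (n + 1)).toReal : EReal) = t (n + 1) :=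
      EReal.coe_toReal hne (fun h => by simp [h] at hpos)
    set x := (t (n + 1)).toReal
    have hxT : x ≤ T := by
      rw [← hx] at h1
      exact_mod_cast h1
    -- The breakpoint `x` also ends the previous segment, so the induction hypothesis applies there;
    -- moving on to `T` costs part of the integral over `seg t (n + 1)`, a term of `absSum` not
    -- spent before.
    have ih' := ih x (hx ▸ hmono (Nat.le_succ n)) hx.le
    have hstep := sum_border_le_add_integral (a := a) hf hr n K hxT
    have hmore : ∑ k ∈ Finset.Ico (n + 1) K, border R a r k x ≤
        ∑ k ∈ Finset.Ico n K, border R a r k x :=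
      Finset.sum_le_sum_of_subset_of_nonneg (Finset.Ico_subset_Ico_left (Nat.le_succ n))
        fun k _ _ => border_nonneg R a hr k x
    rw [Finset.sum_range_succ, ← add_assoc]
    refine (ENNReal.ofReal_le_ofReal (hstep.trans (add_le_add_left hmore _))).trans ?_
    refine ENNReal.ofReal_add_le.trans (add_le_add ih' ?_)
    rw [← intervalIntegral.integral_const_mul, intervalIntegral.integral_of_le hxT,
      ofReal_integral_eq_lintegral_ofReal
        ((border_intervalIntegrable hf r n x T).1.const_mul r)
        (Eventually.of_forall fun τ => mul_nonneg hr (border_nonneg R a hr n τ))]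
    refine le_trans (lintegral_mono fun τ => ?_) (lintegral_mono_set (s := Ioc x T) ?_)
    · rw [← ofReal_norm, norm_mul, norm_exp_ofReal_mul]
      refine ENNReal.ofReal_le_ofReal (le_of_eq ?_)
      simp only [border, norm_mul, norm_pow, Complex.norm_real, norm_neg, Real.norm_eq_abs,
        abs_of_nonneg hr, Complex.ofReal_re]
      rw [show τ * -r = -(r * τ) by ring]
      ring
    · intro τ hτ
      refine ⟨?_, (EReal.coe_le_coe_iff.2 hτ.2).trans h2⟩
      rw [← hx]
      exact EReal.coe_le_coe_iff.2 hτ.1.le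

theorem sum_border_le_absSum (h0 : ∀ β ∈ R, 0 ≤ β) (hf : ∀ T, (R ∩ Iic T).Finite)
    (hmono : Monotone t) (ht0 : t 0 = 0) {r : ℝ} (hr : 0 ≤ r)
    (hconv : ConvergesAt R a t ((-r : ℝ) : ℂ)) (n K : ℕ) (T : ℝ)
    (h1 : t n ≤ T) (h2 : (T : EReal) ≤ t (n + 1)) :
    ∑ k ∈ Finset.Ico n K, border R a r k T ≤ (absSum R a t ((-r : ℝ) : ℂ)).toReal := by
  rw [← ENNReal.ofReal_le_iff_le_toReal (ne_of_lt hconv)]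
  refine (sum_border_le_absSum_aux h0 hf hmono ht0 hr n K T h1 h2).trans ?_
  refine le_trans ?_ le_self_add
  exact add_le_add le_rfl (ENNReal.sum_le_tsum _)

end

/-! ### Truncation of a DIPP and its limit -/

theorem measurableSet_seg (t : ℕ → EReal) (n : ℕ) : MeasurableSet (seg t n) :=
  measurable_coe_real_ereal measurableSet_Icc

noncomputable def integrand (R : Set ℝ) (a : ℝ → ℂ) (m : ℕ) (w : ℂ) (τ : ℝ) : ℂ :=
  iterPrim R a m τ * w ^ (m + 1) * Complex.exp ((τ : ℂ) * w)

noncomputable def borderTerm (R : Set ℝ) (a : ℝ → ℂ) (t : ℕ → EReal) (m : ℕ) (w : ℂ) : ℂ :=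
  if t (m + 1) = ⊤ then 0 else
    (-1) ^ (m + 1) * (iterPrim R a m (t (m + 1)).toReal * w ^ m
      * Complex.exp (((t (m + 1)).toReal : ℂ) * w))

/-- The part of the diagonal integration by parts that lives on `[0, T]`. -/
noncomputable def truncValue (R : Set ℝ) (a : ℝ → ℂ) (t : ℕ → EReal) (w : ℂ) (T : ℝ) : ℂ :=
  (∑' β : {β : ℝ // β ∈ R ∧ (β : EReal) ≤ t 1},
      (Iic T).indicator (fun β : ℝ => a β * Complex.exp ((β : ℂ) * w)) β)
  + (∑' m : ℕ, (-1) ^ (m + 1) * ∫ τ in seg t (m + 1) ∩ Iic T, integrand R a m w τ)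
  + ∑' m : ℕ, if t (m + 1) ≤ (T : EReal) then borderTerm R a t m w else 0

section

variable {R : Set ℝ} {a : ℝ → ℂ} {t : ℕ → EReal}

theorem truncValue_eq_remainder (h0 : ∀ β ∈ R, 0 ≤ β) (hf : ∀ T, (R ∩ Iic T).Finite)
    (ht : ∀ k, 0 ≤ t k) (w : ℂ) {n : ℕ} {T : ℝ} (hT : 0 ≤ T)
    (hn : ∀ k, t k ≤ (T : EReal) ↔ k ≤ n) (hmono : Monotone t) :
    truncValue R a t w T = remainder R a w n T := by
  -- Capping the breakpoints at `T` makes them finite, turns truncated segments into honest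
  -- intervals, and puts the last endpoint `x (n + 1)` at `T`.
  set x : ℕ → ℝ := fun k => (min (t k) (T : EReal)).toReal with hxdef
  have hmin : ∀ k, 0 ≤ min (t k) (T : EReal) := fun k =>
    le_min (ht k) (by exact_mod_cast hT)
  have hx : ∀ k, (x k : EReal) = min (t k) (T : EReal) := fun k =>
    EReal.coe_toReal (ne_of_lt ((min_le_right _ _).trans_lt (EReal.coe_lt_top T)))
      (fun h => by have := hmin k; simp [h] at this)
  have hx0 : ∀ k, 0 ≤ x k := fun k => EReal.toReal_nonneg (hmin k)
  have hxle : ∀ k, k ≤ n → x k = (t k).toReal := fun k hk => by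
    simp only [hxdef, min_eq_left ((hn k).2 hk)]
  have hxn : x (n + 1) = T := by
    have : ¬ t (n + 1) ≤ (T : EReal) := fun h => by have := (hn _).1 h; omega
    simp only [hxdef, min_eq_right (not_le.1 this).le, EReal.toReal_coe]
  have hxmono : Monotone x := fun k l hkl => by
    rw [← EReal.coe_le_coe_iff, hx, hx]
    exact min_le_min_right _ (hmono hkl)
  have key := partial_dipp_eq_remainder (a := a) h0 hf w x hx0 n
  rw [hxn] at key
  rw [← key, truncValue]
  congr 1
  · congr 1
    · have e1 := tsum_subtype {β : ℝ | β ∈ R ∧ (β : EReal) ≤ t 1}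
        ((Iic T).indicator (fun β : ℝ => a β * Complex.exp ((β : ℂ) * w)))
      have e2 := tsum_subtype {β : ℝ | β ∈ R ∧ β ≤ x 1}
        (fun β : ℝ => a β * Complex.exp ((β : ℂ) * w))
      have e3 : {β : ℝ | β ∈ R ∧ (β : EReal) ≤ t 1} ∩ Iic T = {β : ℝ | β ∈ R ∧ β ≤ x 1} := by
        ext β
        simp only [mem_inter_iff, mem_ofPred_eq, mem_Iic]
        rw [← EReal.coe_le_coe_iff (y := x 1), hx, le_min_iff, EReal.coe_le_coe_iff]
        tauto
      rw [indicator_indicator, e3] at e1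
      exact e1.trans e2.symm
    · rw [tsum_eq_sum (s := Finset.range n)]
      · refine Finset.sum_congr rfl fun m hm => ?_
        have hm' := Finset.mem_range.1 hm
        congr 1
        rw [intervalIntegral.integral_of_le (hxmono (Nat.le_succ _)),
          ← integral_Icc_eq_integral_Ioc]
        have : seg t (m + 1) ∩ Iic T = Icc (x (m + 1)) (x (m + 2)) := by
          ext τ
          simp only [seg, mem_inter_iff, mem_ofPred_eq, mem_Iic, mem_Icc]
          rw [← EReal.coe_le_coe_iff (x := x (m + 1)), ← EReal.coe_le_coe_iff (y := x (m + 2)),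
            hx, hx, min_eq_left ((hn (m + 1)).2 hm'), le_min_iff, EReal.coe_le_coe_iff]
          tauto
        rw [this]
        rfl
      · intro m hm
        have hm' : ¬ t (m + 1) ≤ (T : EReal) := fun h => by
          have := (hn _).1 h
          simp only [Finset.mem_range] at hm
          omega
        have : seg t (m + 1) ∩ Iic T = ∅ := by
          ext τ
          simp only [seg, mem_inter_iff, mem_ofPred_eq, mem_Iic, mem_empty_iff_false, iff_false]
          rintro ⟨⟨h, -⟩, h'⟩
          exact hm' (h.trans (EReal.coe_le_coe_iff.2 h'))
        simp [this]
  · rw [tsum_eq_sum (s := Finset.range n)]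
    · refine Finset.sum_congr rfl fun m hm => ?_
      have hm' := (hn (m + 1)).2 (Finset.mem_range.1 hm)
      have hne : t (m + 1) ≠ ⊤ := ne_of_lt (hm'.trans_lt (EReal.coe_lt_top T))
      rw [if_pos hm', borderTerm, if_neg hne, hxle _ (Finset.mem_range.1 hm)]
    · intro m hm
      refine if_neg fun h => ?_
      have := (hn _).1 h
      simp only [Finset.mem_range] at hm
      omega

theorem ConvergesAt.summable_atoms {w : ℂ} (h : ConvergesAt R a t w) :
    Summable fun β : {β : ℝ // β ∈ R ∧ (β : EReal) ≤ t 1} =>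
      ‖a β * Complex.exp (((β : ℝ) : ℂ) * w)‖ := by
  have h1 : (∑' β : {β : ℝ // β ∈ R ∧ (β : EReal) ≤ t 1},
      ‖a β * Complex.exp (((β : ℝ) : ℂ) * w)‖ₑ) ≠ ⊤ :=
    ne_of_lt ((le_self_add.trans le_self_add).trans_lt h)
  have := ENNReal.summable_toReal h1
  simpa using this

theorem ConvergesAt.tsum_lintegral_ne_top {w : ℂ} (h : ConvergesAt R a t w) :
    (∑' m : ℕ, ∫⁻ τ in seg t (m + 1), ‖integrand R a m w τ‖ₑ) ≠ ⊤ :=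
  ne_of_lt ((le_add_self.trans le_self_add).trans_lt h)

theorem integrand_aestronglyMeasurable (hf : ∀ T, (R ∩ Iic T).Finite) (m : ℕ) (w : ℂ) :
    AEStronglyMeasurable (integrand R a m w) volume :=
  ((iterPrim_aestronglyMeasurable hf m).mul_const _).mul
    (Continuous.aestronglyMeasurable (by fun_prop))

theorem ConvergesAt.integrableOn {w : ℂ} (h : ConvergesAt R a t w)
    (hf : ∀ T, (R ∩ Iic T).Finite) (m : ℕ) :
    IntegrableOn (integrand R a m w) (seg t (m + 1)) :=
  ⟨(integrand_aestronglyMeasurable hf m w).restrict,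
    (ENNReal.le_tsum (f := fun m => ∫⁻ τ in seg t (m + 1), ‖integrand R a m w τ‖ₑ) m).trans_lt
      h.tsum_lintegral_ne_top.lt_top⟩

theorem ConvergesAt.summable_integral {w : ℂ} (h : ConvergesAt R a t w)
    (hf : ∀ T, (R ∩ Iic T).Finite) :
    Summable fun m : ℕ => ∫ τ in seg t (m + 1), ‖integrand R a m w τ‖ := by
  refine (ENNReal.summable_toReal h.tsum_lintegral_ne_top).congr fun m => ?_
  rw [integral_norm_eq_lintegral_enorm (integrand_aestronglyMeasurable hf m w).restrict]

theorem ConvergesAt.summable_border {w : ℂ} (h : ConvergesAt R a t w) :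
    Summable fun m : ℕ => ‖borderTerm R a t m w‖ := by
  have h1 : (∑' m : ℕ, if t (m + 1) = ⊤ then 0 else
      ‖iterPrim R a m (t (m + 1)).toReal * w ^ m
        * Complex.exp (((t (m + 1)).toReal : ℂ) * w)‖ₑ) ≠ ⊤ :=
    ne_of_lt (le_add_self.trans_lt h)
  refine (ENNReal.summable_toReal h1).congr fun m => ?_
  by_cases hm : t (m + 1) = ⊤
  · simp [borderTerm, hm]
  · simp [borderTerm, hm]

/-- Dominated convergence for each of the three series, the majorants being the absolute values that
convergence makes summable. -/
theorem ConvergesAt.tendsto_truncValue {w : ℂ} (h : ConvergesAt R a t w)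
    (hf : ∀ T, (R ∩ Iic T).Finite) :
    Tendsto (truncValue R a t w) atTop (𝓝 (value R a t w)) := by
  refine Tendsto.add (Tendsto.add ?_ ?_) ?_
  · refine tendsto_tsum_of_dominated_convergence h.summable_atoms (fun β => ?_) ?_
    · refine tendsto_const_nhds.congr' ?_
      filter_upwards [eventually_ge_atTop (β : ℝ)] with T hT
      rw [indicator_of_mem (mem_Iic.2 hT)]
    · exact Eventually.of_forall fun T β => norm_indicator_le_norm_self
        (fun β : ℝ => a β * Complex.exp ((β : ℂ) * w)) (β : ℝ)
  · refine tendsto_tsum_of_dominated_convergence (h.summable_integral hf) (fun m => ?_) ?_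
    · refine Tendsto.const_mul _ ?_
      have hU : ⋃ T : ℝ, seg t (m + 1) ∩ Iic T = seg t (m + 1) := by
        rw [← inter_iUnion, iUnion_Iic, inter_univ]
      have := tendsto_setIntegral_of_monotone (μ := volume) (f := integrand R a m w)
        (s := fun T : ℝ => seg t (m + 1) ∩ Iic T)
        (fun T => (measurableSet_seg t _).inter measurableSet_Iic)
        (fun T T' hTT => inter_subset_inter_right _ (Iic_subset_Iic.2 hTT))
        (by rw [hU]; exact h.integrableOn hf m)
      rwa [hU] at this
    · refine Eventually.of_forall fun T m => ?_
      rw [norm_mul, norm_pow, norm_neg, norm_one, one_pow, one_mul]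
      refine (norm_integral_le_integral_norm _).trans ?_
      exact setIntegral_mono_set (h.integrableOn hf m).norm
        (Eventually.of_forall fun τ => norm_nonneg _) (inter_subset_left.eventuallyLE)
  · refine tendsto_tsum_of_dominated_convergence h.summable_border (fun m => ?_) ?_
    · by_cases hm : t (m + 1) = ⊤
      · refine tendsto_const_nhds.congr fun T => ?_
        simp [hm]
      · refine tendsto_const_nhds.congr' ?_
        filter_upwards [eventually_ge_atTop (t (m + 1)).toReal] with T hT
        rw [if_pos ((EReal.le_coe_toReal hm).trans (EReal.coe_le_coe_iff.2 hT)), borderTerm]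
    · refine Eventually.of_forall fun T m => ?_
      split_ifs
      · exact le_rfl
      · simp

end

/-! ### Holomorphy of the value -/

theorem norm_exp_mul_le {w w' : ℂ} (hre : w.re ≤ w'.re) {τ : ℝ} (hτ : 0 ≤ τ) :
    ‖Complex.exp ((τ : ℂ) * w)‖ ≤ ‖Complex.exp ((τ : ℂ) * w')‖ := by
  rw [norm_exp_ofReal_mul, norm_exp_ofReal_mul]
  exact Real.exp_le_exp.2 (mul_le_mul_of_nonneg_left hre hτ)

theorem norm_mul_pow_mul_exp_le {w w' : ℂ} (hre : w.re ≤ w'.re) (hn : ‖w‖ ≤ ‖w'‖) (z : ℂ) (k : ℕ)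
    {τ : ℝ} (hτ : 0 ≤ τ) :
    ‖z * w ^ k * Complex.exp ((τ : ℂ) * w)‖ ≤ ‖z * w' ^ k * Complex.exp ((τ : ℂ) * w')‖ := by
  rw [norm_mul, norm_mul, norm_mul, norm_mul, norm_pow, norm_pow]
  gcongr
  exact norm_exp_mul_le hre hτ

theorem differentiableAt_integral_mul_exp {g : ℝ → ℂ} (hg : AEStronglyMeasurable g volume)
    {S : Set ℝ} (hS : MeasurableSet S) (hS0 : S ⊆ Ici 0) {w w' : ℂ} (hw : w.re < w'.re)
    (hi : IntegrableOn (fun τ : ℝ => g τ * Complex.exp ((τ : ℂ) * w')) S) :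
    DifferentiableAt ℂ (fun w : ℂ => ∫ τ in S, g τ * Complex.exp ((τ : ℂ) * w)) w := by
  -- On the ball of radius `δ` a gap of `δ` in the real part remains; it absorbs the factor `τ` of
  -- the derivative through `τ * δ ≤ exp (τ * δ)`.
  set δ := (w'.re - w.re) / 2 with hδ
  have hδ0 : 0 < δ := by linarith
  have hmeas : ∀ z : ℂ, AEStronglyMeasurable (fun τ : ℝ => g τ * Complex.exp ((τ : ℂ) * z))
      (volume.restrict S) := fun z =>
    hg.restrict.mul (Continuous.aestronglyMeasurable (by fun_prop))
  refine (hasDerivAt_integral_of_dominated_loc_of_deriv_le (μ := volume.restrict S)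
    (F := fun w τ => g τ * Complex.exp ((τ : ℂ) * w))
    (F' := fun w τ => g τ * ((τ : ℂ) * Complex.exp ((τ : ℂ) * w)))
    (bound := fun τ => ‖g τ * Complex.exp ((τ : ℂ) * w')‖ / δ)
    (Metric.ball_mem_nhds w hδ0) (Eventually.of_forall hmeas) ?_ ?_ ?_
    (hi.norm.div_const δ) ?_).2.differentiableAt
  · refine Integrable.mono hi (hmeas w) ?_
    filter_upwards [ae_restrict_mem hS] with τ hτ
    rw [norm_mul, norm_mul]
    exact mul_le_mul_of_nonneg_left (norm_exp_mul_le hw.le (hS0 hτ)) (norm_nonneg _)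
  · exact hg.restrict.mul (Continuous.aestronglyMeasurable (by fun_prop))
  · filter_upwards [ae_restrict_mem hS] with τ hτ z hz
    have hτ0 : 0 ≤ τ := hS0 hτ
    have hre : z.re + δ ≤ w'.re := by
      have h1 : |(z - w).re| < δ :=
        (Complex.abs_re_le_norm _).trans_lt (by simpa [dist_eq_norm] using hz)
      have h2 := (abs_lt.1 h1).2
      rw [Complex.sub_re] at h2
      linarith
    rw [norm_mul, norm_mul, norm_mul, mul_div_assoc]
    refine mul_le_mul_of_nonneg_left ?_ (norm_nonneg _)
    rw [le_div_iff₀ hδ0, norm_exp_ofReal_mul, norm_exp_ofReal_mul, Complex.norm_real,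
      Real.norm_eq_abs, abs_of_nonneg hτ0]
    have h1 : τ * z.re + τ * δ ≤ τ * w'.re := by
      rw [← mul_add]
      exact mul_le_mul_of_nonneg_left hre hτ0
    have h2 : τ * δ ≤ Real.exp (τ * δ) := by linarith [Real.add_one_le_exp (τ * δ)]
    calc τ * Real.exp (τ * z.re) * δ = τ * δ * Real.exp (τ * z.re) := by ring
      _ ≤ Real.exp (τ * δ) * Real.exp (τ * z.re) :=
        mul_le_mul_of_nonneg_right h2 (Real.exp_pos _).le
      _ = Real.exp (τ * z.re + τ * δ) := by rw [← Real.exp_add, add_comm]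
      _ ≤ Real.exp (τ * w'.re) := Real.exp_le_exp.2 h1
  · refine Eventually.of_forall fun τ z _ => ?_
    have h : HasDerivAt (fun w : ℂ => (τ : ℂ) * w) ((τ : ℂ) * 1) z :=
      (hasDerivAt_id z).const_mul _
    have := (h.cexp).const_mul (g τ)
    rwa [mul_one, mul_comm (Complex.exp _)] at this

section

variable {R : Set ℝ} {a : ℝ → ℂ} {t : ℕ → EReal}

theorem seg_subset_Ici (ht : ∀ k, 0 ≤ t k) (n : ℕ) : seg t n ⊆ Ici 0 := fun τ hτ => by
  have := (ht n).trans hτ.1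
  exact_mod_cast this

/-- The points dominated by `w'`: every term of the diagonal integration by parts is smaller there
than at `w'`. -/
def dominated (w' : ℂ) : Set ℂ := {w | w.re < w'.re ∧ ‖w‖ < ‖w'‖}

theorem isOpen_dominated (w' : ℂ) : IsOpen (dominated w') :=
  (isOpen_lt Complex.continuous_re continuous_const).inter
    (isOpen_lt continuous_norm continuous_const)

/-- Weierstrass M-test, with the absolute terms at `w'` as majorants on the whole dominated set. -/
theorem differentiableOn_value (h0 : ∀ β ∈ R, 0 ≤ β) (hf : ∀ T, (R ∩ Iic T).Finite)
    (ht : ∀ k, 0 ≤ t k) {w' : ℂ} (h : ConvergesAt R a t w') :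
    DifferentiableOn ℂ (value R a t) (dominated w') := by
  refine DifferentiableOn.add (DifferentiableOn.add ?_ ?_) ?_
  · refine Complex.differentiableOn_tsum_of_summable_norm h.summable_atoms (fun β => ?_)
      (isOpen_dominated w') fun β w hw => ?_
    · fun_prop
    · rw [norm_mul, norm_mul]
      exact mul_le_mul_of_nonneg_left (norm_exp_mul_le hw.1.le (h0 β β.2.1)) (norm_nonneg _)
  · refine Complex.differentiableOn_tsum_of_summable_norm (h.summable_integral hf) (fun m => ?_)
      (isOpen_dominated w') fun m w hw => ?_
    · have e : ∀ w : ℂ, ∫ τ in seg t (m + 1),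
            iterPrim R a m τ * w ^ (m + 1) * Complex.exp ((τ : ℂ) * w) =
          w ^ (m + 1) * ∫ τ in seg t (m + 1), iterPrim R a m τ * Complex.exp ((τ : ℂ) * w) := by
        intro w
        rw [← integral_const_mul]
        congr 1
        ext τ
        ring
      simp only [e]
      intro w hw
      have hw' : w' ≠ 0 := norm_pos_iff.1 ((norm_nonneg w).trans_lt hw.2)
      refine DifferentiableAt.differentiableWithinAt ?_
      refine DifferentiableAt.const_mul (DifferentiableAt.mul (by fun_prop) ?_) _
      refine differentiableAt_integral_mul_exp (iterPrim_aestronglyMeasurable hf m)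
        (measurableSet_seg t _) (seg_subset_Ici ht _) hw.1 ?_
      refine ((h.integrableOn hf m).const_mul ((w' ^ (m + 1))⁻¹)).congr
        (Eventually.of_forall fun τ => ?_)
      simp only [integrand]
      field_simp
    · rw [norm_mul, norm_pow, norm_neg, norm_one, one_pow, one_mul]
      refine norm_integral_le_of_norm_le (h.integrableOn hf m).norm ?_
      filter_upwards [ae_restrict_mem (measurableSet_seg t (m + 1))] with τ hτ
      exact norm_mul_pow_mul_exp_le hw.1.le hw.2.le _ _ (seg_subset_Ici ht _ hτ)
  · refine Complex.differentiableOn_tsum_of_summable_norm h.summable_border (fun m => ?_)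
      (isOpen_dominated w') fun m w hw => ?_
    · by_cases hm : t (m + 1) = ⊤
      · simp only [hm, if_true]
        fun_prop
      · simp only [hm, if_false]
        fun_prop
    · by_cases hm : t (m + 1) = ⊤
      · simp [hm]
      · rw [borderTerm, if_neg hm, if_neg hm, norm_mul ((-1) ^ (m + 1)),
          norm_mul ((-1) ^ (m + 1) : ℂ)]
        exact mul_le_mul_of_nonneg_left (norm_mul_pow_mul_exp_le hw.1.le hw.2.le _ _
          (EReal.toReal_nonneg (ht _))) (norm_nonneg _)

end

/-! ### Growth of the indices and agreement far to the left -/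

section

variable {R : Set ℝ} {a : ℝ → ℂ} {t s : ℕ → EReal}

theorem Admissible.nonneg (ht : Admissible t) (k : ℕ) : 0 ≤ t k :=
  ht.zero ▸ ht.mono (Nat.zero_le k)

theorem Admissible.exists_index (ht : Admissible t) {T : ℝ} (hT : 0 ≤ T) :
    ∃ n, ∀ k, t k ≤ (T : EReal) ↔ k ≤ n := by
  classical
  have hex : ∃ n, (T : EReal) < t n :=
    (ht.tendsto.eventually (lt_mem_nhds (EReal.coe_lt_top T))).exists
  have hpos : Nat.find hex ≠ 0 := by
    intro h
    have h1 := Nat.find_spec hex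
    rw [h, ht.zero] at h1
    exact absurd hT (not_le.2 (by exact_mod_cast h1))
  refine ⟨Nat.find hex - 1, fun k => ⟨fun h => ?_, fun h => ?_⟩⟩
  · by_contra hk
    have h1 : Nat.find hex ≤ k := by omega
    exact absurd (h.trans_lt (Nat.find_spec hex)) (not_lt.2 (ht.mono h1))
  · exact not_lt.1 (Nat.find_min hex (m := k) (by omega))

/-- The positive liminf gives `t n` at least a multiple of `n` beyond some index `N`; the slope here
is the inverse of that multiple, and `N` covers the earlier indices. -/
theorem Admissible.exists_linear_bound (ht : Admissible t) :
    ∃ c : ℝ, 0 ≤ c ∧ ∃ N : ℕ, ∀ (n : ℕ) (T : ℝ), 0 ≤ T → t n ≤ (T : EReal) → (n : ℝ) ≤ N + c * T := by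
  obtain ⟨c, hc0, hc⟩ := EReal.lt_iff_exists_real_btwn.1 ht.growth
  have hc0' : 0 < c := by exact_mod_cast hc0
  obtain ⟨N, hN⟩ := eventually_atTop.1 (eventually_lt_of_lt_liminf hc)
  refine ⟨c⁻¹, (inv_pos.2 hc0').le, N, fun n T hT hn => ?_⟩
  have hcT : 0 ≤ c⁻¹ * T := mul_nonneg (inv_pos.2 hc0').le hT
  rcases le_or_gt n N with h | h
  · have : (n : ℝ) ≤ N := by exact_mod_cast h
    linarith
  · have hn0 : 0 < n := by omega
    have h1 := (hN n h.le).le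
    rw [EReal.le_div_iff_mul_le (by exact_mod_cast hn0) (EReal.natCast_ne_top n)] at h1
    have h2 : c * (n : ℝ) ≤ T := by
      have := h1.trans hn
      exact_mod_cast this
    have h3 : (n : ℝ) ≤ c⁻¹ * T := by
      rw [inv_mul_eq_div, le_div_iff₀ hc0']
      linarith
    have : (0 : ℝ) ≤ N := Nat.cast_nonneg N
    linarith

theorem Admissible.tendsto_two_pow_index (ht : Admissible t) :
    ∃ r₀ : ℝ, 0 < r₀ ∧ ∀ r, r₀ < r → ∀ n : ℝ → ℕ, (∀ T, 0 ≤ T → t (n T) ≤ (T : EReal)) →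
      Tendsto (fun T => 2 ^ n T * Real.exp (-(r * T))) atTop (𝓝 0) := by
  obtain ⟨c, hc, N, hN⟩ := ht.exists_linear_bound
  -- Decay only needs `r > c`, as `2 ^ n ≤ exp n ≤ exp (N + c T)`; adding `1` makes the threshold
  -- positive.
  refine ⟨c + 1, by linarith, fun r hr n hn => ?_⟩
  have hlim : Tendsto (fun T : ℝ => Real.exp N * Real.exp (-((r - c) * T))) atTop (𝓝 0) := by
    rw [← mul_zero (Real.exp N)]
    refine Tendsto.const_mul _ (Real.tendsto_exp_neg_atTop_nhds_zero.comp ?_)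
    exact tendsto_id.const_mul_atTop (by linarith)
  refine squeeze_zero' (Eventually.of_forall fun T => by positivity) ?_ hlim
  filter_upwards [eventually_ge_atTop (0 : ℝ)] with T hT
  have h1 : (2 : ℝ) ^ n T ≤ Real.exp (n T) := by
    rw [← mul_one (n T : ℝ), Real.exp_nat_mul]
    exact pow_le_pow_left₀ (by norm_num) (by linarith [Real.add_one_le_exp (1 : ℝ)]) _
  calc 2 ^ n T * Real.exp (-(r * T)) ≤ Real.exp (N + c * T) * Real.exp (-(r * T)) :=
        mul_le_mul_of_nonneg_right (h1.trans (Real.exp_le_exp.2 (hN _ T hT (hn T hT))))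
          (Real.exp_pos _).le
    _ = Real.exp N * Real.exp (-((r - c) * T)) := by
        rw [← Real.exp_add, ← Real.exp_add]
        congr 1
        ring

/-- The difference consists of the border terms of orders `n` to `m - 1`. Comparing `-2r` with `-r`
gains `2 ^ k * exp (-r T)` with `k < m`, and the sum left over at `-r` is bounded by `absSum`. -/
theorem norm_remainder_sub_le (h0 : ∀ β ∈ R, 0 ≤ β) (hf : ∀ T, (R ∩ Iic T).Finite)
    (ht : Admissible t) {r : ℝ} (hr : 0 ≤ r) (hconv : ConvergesAt R a t ((-r : ℝ) : ℂ))
    {n m : ℕ} (hnm : n ≤ m) {T : ℝ} (h1 : t n ≤ T) (h2 : (T : EReal) ≤ t (n + 1)) :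
    ‖remainder R a ((-(2 * r) : ℝ) : ℂ) n T - remainder R a ((-(2 * r) : ℝ) : ℂ) m T‖ ≤
      2 ^ m * Real.exp (-(r * T)) * (absSum R a t ((-r : ℝ) : ℂ)).toReal := by
  have e : remainder R a ((-(2 * r) : ℝ) : ℂ) n T - remainder R a ((-(2 * r) : ℝ) : ℂ) m T =
      ∑ k ∈ Finset.Ico n m, (-1) ^ k * (iterPrim R a k T * ((-(2 * r) : ℝ) : ℂ) ^ k
        * Complex.exp ((T : ℂ) * ((-(2 * r) : ℝ) : ℂ))) := by
    rw [Finset.sum_Ico_eq_sub _ hnm, remainder, remainder]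
    ring
  rw [e]
  refine (norm_sum_le _ _).trans ?_
  refine le_trans ?_ (mul_le_mul_of_nonneg_left
    (sum_border_le_absSum h0 hf ht.mono ht.zero hr hconv n m T h1 h2) (by positivity))
  rw [Finset.mul_sum]
  refine Finset.sum_le_sum fun k hk => ?_
  have hk' : (2 : ℝ) ^ k ≤ 2 ^ m :=
    pow_le_pow_right₀ (by norm_num) (Finset.mem_Ico.1 hk).2.le
  rw [norm_mul, norm_pow, norm_neg, norm_one, one_pow, one_mul, norm_mul, norm_mul, norm_pow,
    norm_exp_ofReal_mul, Complex.norm_real, norm_neg, Real.norm_eq_abs,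
    abs_of_nonneg (by positivity), Complex.ofReal_re, mul_pow, border,
    show T * -(2 * r) = -(r * T) + -(r * T) by ring, Real.exp_add]
  have := mul_le_mul_of_nonneg_right hk' (show 0 ≤ ‖iterPrim R a k T‖ * r ^ k *
    (Real.exp (-(r * T)) * Real.exp (-(r * T))) by positivity)
  linarith

/-- Two diagonal integrations by parts agree far to the left on the real axis. -/
theorem exists_value_eq_of_large (h0 : ∀ β ∈ R, 0 ≤ β) (hf : ∀ T, (R ∩ Iic T).Finite)
    (ht : Admissible t) (hs : Admissible s) :
    ∃ r₀ : ℝ, 0 < r₀ ∧ ∀ r, r₀ < r →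
      ConvergesAt R a t ((-r : ℝ) : ℂ) → ConvergesAt R a s ((-r : ℝ) : ℂ) →
      ConvergesAt R a t ((-(2 * r) : ℝ) : ℂ) → ConvergesAt R a s ((-(2 * r) : ℝ) : ℂ) →
      value R a t ((-(2 * r) : ℝ) : ℂ) = value R a s ((-(2 * r) : ℝ) : ℂ) := by
  obtain ⟨r₁, hr₁, H₁⟩ := ht.tendsto_two_pow_index
  obtain ⟨r₂, hr₂, H₂⟩ := hs.tendsto_two_pow_index
  refine ⟨max r₁ r₂, lt_max_of_lt_left hr₁, fun r hr ct cs ct' cs' => ?_⟩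
  have hr0 : 0 ≤ r := (hr₁.trans ((le_max_left _ _).trans_lt hr)).le
  have hnt : ∀ T : ℝ, ∃ n, 0 ≤ T → ∀ k, t k ≤ (T : EReal) ↔ k ≤ n := fun T => by
    by_cases hT : 0 ≤ T
    · obtain ⟨n, hn⟩ := ht.exists_index hT
      exact ⟨n, fun _ => hn⟩
    · exact ⟨0, fun h => absurd h hT⟩
  have hns : ∀ T : ℝ, ∃ n, 0 ≤ T → ∀ k, s k ≤ (T : EReal) ↔ k ≤ n := fun T => by
    by_cases hT : 0 ≤ T
    · obtain ⟨n, hn⟩ := hs.exists_index hT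
      exact ⟨n, fun _ => hn⟩
    · exact ⟨0, fun h => absurd h hT⟩
  choose n hn using hnt
  choose m hm using hns
  have l1 := H₁ r ((le_max_left _ _).trans_lt hr) n fun T hT => (hn T hT _).2 le_rfl
  have l2 := H₂ r ((le_max_right _ _).trans_lt hr) m fun T hT => (hm T hT _).2 le_rfl
  set A := (absSum R a t ((-r : ℝ) : ℂ)).toReal
  set B := (absSum R a s ((-r : ℝ) : ℂ)).toReal
  have hA : 0 ≤ A := ENNReal.toReal_nonneg
  have hB : 0 ≤ B := ENNReal.toReal_nonneg
  -- The constant belongs to the sequence with the smaller index and the power of `2` to the larger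
  -- one; which is which may vary with `T`, so both bounds are added.
  have hlim : Tendsto (fun T => 2 ^ m T * Real.exp (-(r * T)) * A
      + 2 ^ n T * Real.exp (-(r * T)) * B) atTop (𝓝 0) := by
    simpa using (l2.mul_const A).add (l1.mul_const B)
  have hdiff : Tendsto (fun T => truncValue R a t ((-(2 * r) : ℝ) : ℂ) T
      - truncValue R a s ((-(2 * r) : ℝ) : ℂ) T) atTop (𝓝 0) := by
    refine squeeze_zero_norm' ?_ hlim
    filter_upwards [eventually_ge_atTop (0 : ℝ)] with T hT
    rw [truncValue_eq_remainder h0 hf ht.nonneg _ hT (hn T hT) ht.mono,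
      truncValue_eq_remainder h0 hf hs.nonneg _ hT (hm T hT) hs.mono]
    have p1 : 0 ≤ 2 ^ m T * Real.exp (-(r * T)) * A := by positivity
    have p2 : 0 ≤ 2 ^ n T * Real.exp (-(r * T)) * B := by positivity
    have q1 : (T : EReal) ≤ t (n T + 1) :=
      (not_le.1 fun h => by have := (hn T hT _).1 h; omega).le
    have q2 : (T : EReal) ≤ s (m T + 1) :=
      (not_le.1 fun h => by have := (hm T hT _).1 h; omega).le
    rcases le_total (n T) (m T) with h | h
    · have := norm_remainder_sub_le h0 hf ht hr0 ct h ((hn T hT _).2 le_rfl) q1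
      linarith
    · have := norm_remainder_sub_le h0 hf hs hr0 cs h ((hm T hT _).2 le_rfl) q2
      rw [norm_sub_rev]
      linarith
  have hval := (ct'.tendsto_truncValue hf).sub (cs'.tendsto_truncValue hf)
  exact sub_eq_zero.1 (tendsto_nhds_unique hval hdiff)

end

/-! ### The dominated hull and connectedness -/

/-- The union of the sets dominated by the points of `H`. -/
def domHull (H : Set ℂ) : Set ℂ := ⋃ w' ∈ H, dominated w'

theorem isOpen_domHull (H : Set ℂ) : IsOpen (domHull H) :=
  isOpen_biUnion fun w' _ => isOpen_dominated w'

theorem mem_domHull {H : Set ℂ} {w : ℂ} :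
    w ∈ domHull H ↔ ∃ w' ∈ H, w.re < w'.re ∧ ‖w‖ < ‖w'‖ := by
  simp only [domHull, dominated, mem_iUnion, exists_prop, mem_ofPred_eq]

/-- Moving right may decrease the modulus when `w.re < 0`. A small vertical step away from the real
axis first increases it strictly, leaving room for a tiny step to the right. -/
theorem exists_dominating {H : Set ℂ} (hH : IsOpen H) {w : ℂ} (hw : w ∈ H) :
    ∃ w' ∈ H, w.re < w'.re ∧ ‖w‖ < ‖w'‖ := by
  obtain ⟨η, hη, hη'⟩ : ∃ η : ℝ, w + η * Complex.I ∈ H ∧ ‖w‖ < ‖w + η * Complex.I‖ := by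
    obtain ⟨ε, hε, hball⟩ := Metric.isOpen_iff.1 hH w hw
    set η : ℝ := if 0 ≤ w.im then ε / 2 else -(ε / 2) with hη
    have habs : |η| = ε / 2 := by
      rw [hη]
      split_ifs
      · exact abs_of_pos (by linarith)
      · rw [abs_neg, abs_of_pos (by linarith)]
    have hprod : 0 ≤ w.im * η := by
      rw [hη]
      split_ifs with h
      · positivity
      · exact mul_nonneg_of_nonpos_of_nonpos (not_le.1 h).le (by linarith)
    refine ⟨η, hball ?_, ?_⟩
    · simp only [Metric.mem_ball, dist_eq_norm, add_sub_cancel_left, norm_mul, Complex.norm_real,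
        Complex.norm_I, Real.norm_eq_abs, habs]
      linarith
    · refine lt_of_pow_lt_pow_left₀ 2 (norm_nonneg _) ?_
      rw [Complex.sq_norm, Complex.sq_norm, Complex.normSq_apply, Complex.normSq_apply]
      simp only [Complex.add_re, Complex.add_im, Complex.mul_re, Complex.mul_im,
        Complex.ofReal_re, Complex.ofReal_im, Complex.I_re, Complex.I_im]
      have : 0 < η * η := by
        rw [← abs_mul_abs_self, habs]
        positivity
      nlinarith
  have hcont : Tendsto (fun δ : ℝ => w + η * Complex.I + (δ : ℂ)) (𝓝[>] 0)
      (𝓝 (w + η * Complex.I)) := by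
    have : Continuous fun δ : ℝ => w + η * Complex.I + (δ : ℂ) := by fun_prop
    have h := this.tendsto 0
    simp only [Complex.ofReal_zero, add_zero] at h
    exact h.mono_left nhdsWithin_le_nhds
  have ev := ((hcont.eventually (hH.mem_nhds hη)).and
    (hcont.norm.eventually (lt_mem_nhds hη'))).and self_mem_nhdsWithin
  obtain ⟨δ, ⟨h1, h2⟩, h3⟩ := ev.exists
  refine ⟨_, h1, ?_, h2⟩
  have h3' : (0 : ℝ) < δ := h3
  simpa using h3'

theorem subset_domHull {H : Set ℂ} (hH : IsOpen H) : H ⊆ domHull H := fun _ hw =>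
  mem_domHull.2 (exists_dominating hH hw)

theorem IsNbhdNegInf.exists_ofReal_mem {H : Set ℂ} (hH : IsNbhdNegInf H) :
    ∃ c : ℝ, ∀ x : ℝ, x < c → (x : ℂ) ∈ H := by
  obtain ⟨c, hc⟩ := hH (Real.pi / 4) (by positivity) (by linarith [Real.pi_pos])
  refine ⟨c, fun x hx => hc ?_⟩
  simp [hx]

theorem mem_domHull_of_im_le {H : Set ℂ} {w z : ℂ} (hw : w ∈ domHull H) (hre : z.re = w.re)
    (him : |z.im| ≤ |w.im|) : z ∈ domHull H := by
  obtain ⟨w', hw', h1, h2⟩ := mem_domHull.1 hw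
  refine mem_domHull.2 ⟨w', hw', hre ▸ h1, lt_of_le_of_lt ?_ h2⟩
  refine le_of_sq_le_sq ?_ (norm_nonneg _)
  rw [Complex.sq_norm, Complex.sq_norm, Complex.normSq_apply, Complex.normSq_apply, hre]
  have := sq_le_sq.2 him
  nlinarith

/-- Connectedness makes `H` meet every vertical line between its far left real points and a point
dominating `w`; from such a meeting point one descends vertically to the real axis inside the hull.
-/
theorem ofReal_mem_domHull_of_le {H : Set ℂ} (hH : IsNbhdNegInf H) (ho : IsOpen H)
    (hc : IsConnected H) {w : ℂ} (hw : w ∈ domHull H) {x : ℝ} (hx : x ≤ w.re) :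
    (x : ℂ) ∈ domHull H := by
  obtain ⟨w', hw', h1, -⟩ := mem_domHull.1 hw
  obtain ⟨c, hcH⟩ := hH.exists_ofReal_mem
  have hy : ((min c x - 1 : ℝ) : ℂ) ∈ H := hcH _ (by linarith [min_le_left c x])
  obtain ⟨z, hz, hzx⟩ := hc.isPreconnected.intermediate_value hy hw'
    Complex.continuous_re.continuousOn (show x ∈ Icc _ _ from
      ⟨by rw [Complex.ofReal_re]; linarith [min_le_right c x], by linarith⟩)
  exact mem_domHull_of_im_le (subset_domHull ho hz) (by simp [hzx]) (by simp)

/-- Two points are joined by dropping both vertically to the real axis and connecting their feet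
along it. Each piece stays in both hulls, since their real traces extend indefinitely to the left.
-/
theorem isPreconnected_domHull_inter {H H' : Set ℂ} (hH : IsNbhdNegInf H) (ho : IsOpen H)
    (hc : IsConnected H) (hH' : IsNbhdNegInf H') (ho' : IsOpen H') (hc' : IsConnected H') :
    IsPreconnected (domHull H ∩ domHull H') := by
  refine isPreconnected_of_forall_pair fun w hw z hz => ?_
  have vert : ∀ w ∈ domHull H ∩ domHull H',
      segment ℝ w (w.re : ℂ) ⊆ domHull H ∩ domHull H' := by
    rintro w ⟨h1, h2⟩ _ ⟨p, q, hp, hq, hpq, rfl⟩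
    have hre : (p • w + q • (w.re : ℂ)).re = w.re := by
      simp only [Complex.add_re, Complex.real_smul, Complex.re_ofReal_mul, Complex.ofReal_re]
      rw [← add_mul, hpq, one_mul]
    have him : |(p • w + q • (w.re : ℂ)).im| ≤ |w.im| := by
      simp only [Complex.add_im, Complex.real_smul, Complex.im_ofReal_mul, Complex.ofReal_im,
        mul_zero, add_zero, abs_mul, abs_of_nonneg hp]
      exact mul_le_of_le_one_left (abs_nonneg _) (by linarith)
    exact ⟨mem_domHull_of_im_le h1 hre him, mem_domHull_of_im_le h2 hre him⟩
  have horiz : segment ℝ (w.re : ℂ) (z.re : ℂ) ⊆ domHull H ∩ domHull H' := by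
    rintro _ ⟨p, q, hp, hq, hpq, rfl⟩
    have e : p • (w.re : ℂ) + q • (z.re : ℂ) = ((p * w.re + q * z.re : ℝ) : ℂ) := by
      simp
    rw [e]
    rcases le_total w.re z.re with h | h
    · have hle : p * w.re + q * z.re ≤ z.re := by
        have h1 := mul_le_mul_of_nonneg_left h hp
        have h2 : p * z.re + q * z.re = z.re := by rw [← add_mul, hpq, one_mul]
        linarith
      exact ⟨ofReal_mem_domHull_of_le hH ho hc hz.1 hle,
        ofReal_mem_domHull_of_le hH' ho' hc' hz.2 hle⟩
    · have hle : p * w.re + q * z.re ≤ w.re := by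
        have h1 := mul_le_mul_of_nonneg_left h hq
        have h2 : p * w.re + q * w.re = w.re := by rw [← add_mul, hpq, one_mul]
        linarith
      exact ⟨ofReal_mem_domHull_of_le hH ho hc hw.1 hle,
        ofReal_mem_domHull_of_le hH' ho' hc' hw.2 hle⟩
  refine ⟨segment ℝ w (w.re : ℂ) ∪ segment ℝ (w.re : ℂ) (z.re : ℂ) ∪ segment ℝ z (z.re : ℂ),
    union_subset (union_subset (vert w hw) horiz) (vert z hz),
    Or.inl (Or.inl (left_mem_segment ℝ _ _)), Or.inr (left_mem_segment ℝ _ _), ?_⟩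
  refine IsPreconnected.union (z.re : ℂ) (Or.inr (right_mem_segment ℝ _ _))
    (right_mem_segment ℝ _ _) ?_ (convex_segment _ _).isPreconnected
  exact IsPreconnected.union (w.re : ℂ) (right_mem_segment ℝ _ _) (left_mem_segment ℝ _ _)
    (convex_segment _ _).isPreconnected (convex_segment _ _).isPreconnected

theorem analyticOnNhd_value {R : Set ℝ} {a : ℝ → ℂ} {t : ℕ → EReal} (h0 : ∀ β ∈ R, 0 ≤ β)
    (hf : ∀ T, (R ∩ Iic T).Finite) (ht : Admissible t) {H : Set ℂ}
    (hH : ∀ w ∈ H, ConvergesAt R a t w) : AnalyticOnNhd ℂ (value R a t) (domHull H) := by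
  refine DifferentiableOn.analyticOnNhd (fun w hw => ?_) (isOpen_domHull H)
  obtain ⟨w', hw', h⟩ := mem_domHull.1 hw
  exact ((differentiableOn_value h0 hf ht.nonneg (hH w' hw')).differentiableAt
    ((isOpen_dominated w').mem_nhds h)).differentiableWithinAt

end DIPP

theorem mainTheorem4
    (R : Set ℝ) (hR_nonneg : ∀ β ∈ R, 0 ≤ β) (hR_closed : IsClosed R)
    (hR_discrete : DiscreteTopology R) (a : ℝ → ℂ)
    (t s : ℕ → EReal) (ht : DIPP.Admissible t) (hs : DIPP.Admissible s)
    (Ht Hs : Set ℂ)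
    (hHt : DIPP.IsNbhdNegInf Ht) (hHt_open : IsOpen Ht) (hHt_conn : IsConnected Ht)
    (hHs : DIPP.IsNbhdNegInf Hs) (hHs_open : IsOpen Hs) (hHs_conn : IsConnected Hs)
    (hconv_t : ∀ w ∈ Ht, DIPP.ConvergesAt R a t w)
    (hconv_s : ∀ w ∈ Hs, DIPP.ConvergesAt R a s w) :
    ∀ w ∈ Ht ∩ Hs, DIPP.value R a t w = DIPP.value R a s w := by
  intro w hw
  have hf := DIPP.finite_inter_Iic hR_nonneg hR_closed hR_discrete
  obtain ⟨ct, hct⟩ := hHt.exists_ofReal_mem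
  obtain ⟨cs, hcs⟩ := hHs.exists_ofReal_mem
  obtain ⟨r₀, hr₀, heq⟩ := DIPP.exists_value_eq_of_large (a := a) hR_nonneg hf ht hs
  set ρ : ℝ := max (max (-ct) (-cs)) r₀ with hρ
  have hρt : -ct ≤ ρ := (le_max_left _ _).trans (le_max_left _ _)
  have hρs : -cs ≤ ρ := (le_max_right _ _).trans (le_max_left _ _)
  have hρ₀ : r₀ ≤ ρ := le_max_right _ _
  have hev : ∀ x : ℝ, x < -(2 * ρ) → DIPP.value R a t (x : ℂ) = DIPP.value R a s (x : ℂ) := by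
    intro x hx
    -- With `r = -x / 2`, both `-r = x / 2` and `-2r = x` lie left of `-ρ`, hence in `Ht` and `Hs`.
    have h := heq (-x / 2) (by linarith) (hconv_t _ (hct _ (by linarith)))
      (hconv_s _ (hcs _ (by linarith))) (hconv_t _ (hct _ (by linarith)))
      (hconv_s _ (hcs _ (by linarith)))
    rwa [show -(2 * (-x / 2)) = x by ring] at h
  set x₀ : ℝ := -(2 * ρ) - 1 with hx₀
  have hmem : (x₀ : ℂ) ∈ DIPP.domHull Ht ∩ DIPP.domHull Hs :=
    ⟨DIPP.subset_domHull hHt_open (hct _ (by linarith)),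
      DIPP.subset_domHull hHs_open (hcs _ (by linarith))⟩
  have hfreq : ∃ᶠ z in 𝓝[≠] (x₀ : ℂ), DIPP.value R a t z = DIPP.value R a s z := by
    -- Real points to the left of `x₀` supply the accumulating coincidences required by the identity
    -- theorem.
    have htend : Tendsto (fun x : ℝ => (x : ℂ)) (𝓝[<] x₀) (𝓝[≠] (x₀ : ℂ)) := by
      refine tendsto_nhdsWithin_iff.2 ⟨(Complex.continuous_ofReal.tendsto x₀).mono_left
        nhdsWithin_le_nhds, ?_⟩
      filter_upwards [self_mem_nhdsWithin] with x hx
      simpa using ne_of_lt hx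
    refine htend.frequently (Eventually.frequently ?_)
    filter_upwards [self_mem_nhdsWithin] with x hx
    have hx' : x < x₀ := hx
    exact hev x (by linarith)
  exact ((DIPP.analyticOnNhd_value hR_nonneg hf ht hconv_t).mono
    Set.inter_subset_left).eqOn_of_preconnected_of_frequently_eq
    ((DIPP.analyticOnNhd_value hR_nonneg hf hs hconv_s).mono Set.inter_subset_right)
    (DIPP.isPreconnected_domHull_inter hHt hHt_open hHt_conn hHs hHs_open hHs_conn) hmem hfreq
    ⟨DIPP.subset_domHull hHt_open hw.1, DIPP.subset_domHull hHs_open hw.2⟩
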